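/- For $n\ge 0$ let $\Delta_n=\{(x_0,\dots,x_n)\in\mathbb R^{n+1} : x_l\ge 0,\ \sum_l x_l=1\}$ with the Euclidean topology. For $n\ge1$, $i\in\{0,1\}$ and $j\in\{0,\dots,n\}$ put $v=\frac{i}{2(n+1)}$ and let $\langle id\rangle_{n,i,j}:\Delta_{n-1}\to\Delta_n$ be the map $$(x_0,\dots,x_{n-1})\mapsto\big((1-v)x_0,\dots,(1-v)x_{j-1},\,v,\,(1-v)x_j,\dots,(1-v)x_{n-1}\big).$$ Let $\mathcal{COMFORT}(\Delta_n)$ be the set of homeomorphisms $F:\Delta_n\to\Delta_n$ that respect permutations (if $F(x)=y$, then $F(x_{\vartheta(0)},\dots,x_{\vartheta(n)})=(y_{\vartheta(0)},\dots,y_{\vartheta(n)})$ for every permutation $\vartheta$ of $\{0,\dots,n\}$) and keep the order (if $F(x)=y$ and $x_{\vartheta(0)}\le\dots\le x_{\vartheta(n)}$, then $y_{\vartheta(0)}\le\dots\le y_{\vartheta(n)}$). For $\alpha\in[0,1]$ the $\alpha$-cross of $\Delta_n$ is the set of the $x\in\Delta_n$ that have at least one coordinate equal to $\alpha$. For an increasing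 homeomorphism $f$ of $[0,\frac1{n+1}]$ let $\Lambda_n(f)$ be the map $x\mapsto y$ on $\Delta_n$ with $y_l=f(x_l)$ if $x_l\le\frac1{n+1}$ and $y_l=x_l+\delta\,(x_l-\frac1{n+1})$ if $x_l>\frac1{n+1}$, where $$\delta=\frac{\sum_{x_l\le 1/(n+1)}(x_l-f(x_l))}{\sum_{x_l>1/(n+1)}(x_l-\frac1{n+1})}.$$ Let $\phi_{n,0}$ be the piecewise linear function on $[0,\frac1{n+1}]$ through $(0,0)$, $\big(\frac1{2(n+1)},\frac1{2(n+2)}\big)$, $\big(\frac1{n+1},\frac1{n+1}\big)$, and put $\Theta_{n,0}=\Lambda_n(\phi_{n,0})$ for all $n\ge0$. **Theorem.** For every $n\ge 0$ the map $\Theta_{n,0}$ is an element of $\mathcal{COMFORT}(\Delta_n)$, and there are homeomorphisms $\Theta_{n,1}\in\mathcal{COMFORT}(\Delta_n)$, $n\ge 0$, with the following properties. 1. For all $n\ge1$, all $j,p\in\{0,\dots,n\}$ with $j\le p$ and all $i,k\in\{0,1\}$, as maps $\Delta_{n-1}\to\Delta_{n+1}$, $$\langle id\rangle_{n+1,i,j}\circ\Theta_{n,i}\circ\langle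 id\rangle_{n,k,p}\circ\Theta_{n-1,k}=\langle id\rangle_{n+1,k,p+1}\circ\Theta_{n,k}\circ\langle id\rangle_{n,i,j}\circ\Theta_{n-1,i}.$$ 2. For every $n\ge0$, $\Theta_{n,1}$ restricts to a homeomorphism of the $\frac1{2(n+1)}$-cross of $\Delta_n$ onto the $\frac1{2(n+1)+1}$-cross of $\Delta_n$. 3. Let $R$ be a commutative ring with unit, $(m_0,m_1)\in R^2$, $X$ a topological space, and $\mathcal F_n(X)$ the free $R$-module on the continuous maps $\Delta_n\to X$. Let $\partial_n:\mathcal F_n(X)\to\mathcal F_{n-1}(X)$, $n\ge1$, be the $R$-linear map with $$\partial_n(T)=\sum_{j=0}^n(-1)^j\sum_{i=0}^1 m_i\,\big[T\circ\langle id\rangle_{n,i,j}\circ\Theta_{n-1,i}\big]$$ for every continuous $T:\Delta_n\to X$. Then $\partial_n\circ\partial_{n+1}=0$ for all $n\ge1$; that is, the modules $\mathcal F_n(X)$, $n\ge 0$, with the maps $\partial_n$ (and $\partial_0=0$) form a chain complex. -/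

import Mathlib

open scoped BigOperators

noncomputable section

namespace SimplexBoundary

/-- The standard `n`-simplex `Δ_n ⊆ ℝ^{n+1}` with the Euclidean topology. -/
abbrev Simplex (n : ℕ) : Type := stdSimplex ℝ (Fin (n + 1))

/-- The height `v = i / ((L + 1) (n + 1))` of the `i`-th simplex parallel to a face of `Δ_n`. -/
def height (L n : ℕ) (i : Fin (L + 1)) : ℝ :=
  ((i : ℕ) : ℝ) / (((L : ℝ) + 1) * ((n : ℝ) + 1))

theorem height_nonneg (L n : ℕ) (i : Fin (L + 1)) : 0 ≤ height L n i := by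
  unfold height
  positivity

theorem height_le_one (L n : ℕ) (i : Fin (L + 1)) : height L n i ≤ 1 := by
  unfold height
  have hi : ((i : ℕ) : ℝ) ≤ (L : ℝ) := by exact_mod_cast Nat.lt_succ_iff.mp i.isLt
  have hL : (0 : ℝ) ≤ L := Nat.cast_nonneg L
  have hn : (0 : ℝ) ≤ n := Nat.cast_nonneg n
  rw [div_le_one (by positivity)]
  nlinarith [mul_nonneg hL hn]

/-- The map `⟨id⟩_{L, n+1, i, j} : Δ_n → Δ_{n+1}`,
`(x_0, …, x_n) ↦ (y_0, …, y_{j-1}, v, y_j, …, y_n)` with `v = i / ((L + 1) (n + 2))` and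
`y_k = (1 - v) x_k`. -/
def faceMap (L n : ℕ) (i : Fin (L + 1)) (j : Fin (n + 2)) : C(Simplex n, Simplex (n + 1)) where
  toFun x :=
    ⟨j.insertNth (α := fun _ => ℝ) (height L (n + 1) i)
        (fun k => (1 - height L (n + 1) i) * x k), by
      refine ⟨fun k => ?_, ?_⟩
      · refine Fin.succAboveCases j ?_ (fun l => ?_) k
        · simpa using height_nonneg L (n + 1) i
        · simp only [Fin.insertNth_apply_succAbove]
          exact mul_nonneg (sub_nonneg.mpr (height_le_one L (n + 1) i)) (x.2.1 l)
      · rw [Fin.sum_univ_succAbove _ j]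
        simp only [Fin.insertNth_apply_same, Fin.insertNth_apply_succAbove]
        have hx : ∑ l, x l = 1 := x.2.2
        rw [← Finset.mul_sum, hx]
        ring⟩
  continuous_toFun := by
    refine Continuous.subtype_mk (continuous_pi fun k => ?_) _
    refine Fin.succAboveCases j ?_ (fun l => ?_) k
    · simpa using continuous_const
    · simp only [Fin.insertNth_apply_succAbove]
      exact continuous_const.mul ((continuous_apply l).comp continuous_subtype_val)

/-- A family of self-homeomorphisms `Θ_{L,n,i}` of `Δ_n`, for `n ≥ 0` and `i = 0, …, L`. -/
abbrev HomeoFamily (L : ℕ) : Type := (n : ℕ) → Fin (L + 1) → (Simplex n ≃ₜ Simplex n)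

/-- With `N = n + 1 ≥ 1` and `j, p ∈ {0, …, N}`, the equation
`⟨id⟩_{N+1,i,j} ∘ Θ_{N,i} ∘ ⟨id⟩_{N,k,p} ∘ Θ_{N-1,k}
  = ⟨id⟩_{N+1,k,p+1} ∘ Θ_{N,k} ∘ ⟨id⟩_{N,i,j} ∘ Θ_{N-1,i}` of maps `Δ_{N-1} → Δ_{N+1}`. -/
def FaceEquation (L : ℕ) (Θ : HomeoFamily L) (n : ℕ) (j p : Fin (n + 2))
    (i k : Fin (L + 1)) : Prop :=
  ∀ x : Simplex n,
    faceMap L (n + 1) i j.castSucc (Θ (n + 1) i (faceMap L n k p (Θ n k x))) =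
      faceMap L (n + 1) k p.succ (Θ (n + 1) k (faceMap L n i j (Θ n i x)))

/-- `F` respects permutations of the coordinates. -/
def RespectsPermutations {n : ℕ} (F : Simplex n → Simplex n) : Prop :=
  ∀ (σ : Equiv.Perm (Fin (n + 1))) (x x' : Simplex n),
    (∀ l, x' l = x (σ l)) →
      ∀ l, (F x') l = (F x) (σ l)

/-- `F` keeps the order of the coordinates: a permutation that sorts the coordinates of `x`
sorts those of `F x`. -/
def KeepsOrder {n : ℕ} (F : Simplex n → Simplex n) : Prop :=
  ∀ (x : Simplex n) (σ : Equiv.Perm (Fin (n + 1))),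
    Monotone (fun l => x (σ l)) →
      Monotone (fun l => (F x) (σ l))

/-- `COMFORT(Δ_n)`: the homeomorphisms of `Δ_n` that respect permutations and keep the order. -/
def Comfort (n : ℕ) : Set (Simplex n ≃ₜ Simplex n) :=
  {F | RespectsPermutations F ∧ KeepsOrder F}

/-- The `α`-cross of `Δ_n`. -/
def cross (n : ℕ) (α : ℝ) : Set (Simplex n) :=
  {x | ∃ j, x j = α}

/-- The number `D` in the construction of `Λ_n(f)`: the total decrease of the coordinates that
are at most `1 / (n + 1)` when `f` is applied to them. -/
def lambdaD (n : ℕ) (f : ℝ → ℝ) (x : Fin (n + 1) → ℝ) : ℝ :=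
  ∑ i, if x i ≤ 1 / ((n : ℝ) + 1) then x i - f (x i) else 0

/-- The number `δ` in the construction of `Λ_n(f)`. -/
def lambdaDelta (n : ℕ) (f : ℝ → ℝ) (x : Fin (n + 1) → ℝ) : ℝ :=
  lambdaD n f x /
    ∑ i, if x i ≤ 1 / ((n : ℝ) + 1) then 0 else x i - 1 / ((n : ℝ) + 1)

/-- The coordinates of `Λ_n(f)(x)`, for `f` an increasing homeomorphism of `[0, 1 / (n + 1)]`:
`f` is applied to the coordinates that are at most `1 / (n + 1)`, and the excess over
`1 / (n + 1)` of each other coordinate is multiplied by `1 + δ`. -/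
def Lambda (n : ℕ) (f : ℝ → ℝ) (x : Fin (n + 1) → ℝ) : Fin (n + 1) → ℝ := fun i =>
  if x i ≤ 1 / ((n : ℝ) + 1) then f (x i)
  else x i + lambdaDelta n f x * (x i - 1 / ((n : ℝ) + 1))

/-- The affine function through `(a, b)` and `(c, d)`, for `a ≠ c`. -/
def lineThrough (a b c d t : ℝ) : ℝ := b + (d - b) / (c - a) * (t - a)

/-- `φ_{n,0}`: the polygon through `(0, 0)`, `(1 / (2 (n + 1)), 1 / (2 (n + 2)))` and
`(1 / (n + 1), 1 / (n + 1))`. -/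
def phi (n : ℕ) (t : ℝ) : ℝ :=
  if t ≤ 1 / (2 * ((n : ℝ) + 1)) then
    lineThrough 0 0 (1 / (2 * ((n : ℝ) + 1))) (1 / (2 * ((n : ℝ) + 2))) t
  else
    lineThrough (1 / (2 * ((n : ℝ) + 1))) (1 / (2 * ((n : ℝ) + 2)))
      (1 / ((n : ℝ) + 1)) (1 / ((n : ℝ) + 1)) t

/-- The singular `n`-chains of `X`: the free `R`-module on the continuous maps `Δ_n → X`. -/
abbrev Chain (R : Type*) [CommRing R] (X : Type*) [TopologicalSpace X] (n : ℕ) : Type _ :=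
  C(Simplex n, X) →₀ R

/-- The operator `∂_{n+1}` from `(n+1)`-chains to `n`-chains, the linear extension of
`T ↦ ∑_{j=0}^{n+1} (-1)^j ∑_{i=0}^{L} m_i [⟨T⟩_{L,n+1,i,j} ∘ Θ_{L,n,i}]`,
where `⟨T⟩_{L,n+1,i,j} = T ∘ ⟨id⟩_{L,n+1,i,j}`. -/
def boundary {L : ℕ} (Θ : HomeoFamily L) {R : Type*} [CommRing R] (m : Fin (L + 1) → R)
    (X : Type*) [TopologicalSpace X] (n : ℕ) : Chain R X (n + 1) →ₗ[R] Chain R X n :=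
  Finsupp.linearCombination R fun T : C(Simplex (n + 1), X) =>
    ∑ j : Fin (n + 2), (-1 : R) ^ (j : ℕ) • ∑ i : Fin (L + 1),
      m i • Finsupp.single ((T.comp (faceMap L n i j)).comp
        (Θ n i : C(Simplex n, Simplex n))) (1 : R)

end SimplexBoundary

end

open SimplexBoundary

open scoped BigOperators

noncomputable section

namespace SimplexBoundary

variable {n : ℕ}

/-! Write `Z n` for Θ_{n,0}, `F n` for Θ_{n,1}, l_n = 1/(2(n+1)) for `level n` and c_n =
1/(2(n+1)+1) for `crossLevel n`. Compared coordinate by coordinate, the face equation splits into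
conditions on the two inserted coordinates and on the others. The former hold if `Z n` multiplies
coordinates up to l_n linearly so that l_n goes to l_{n+1}, and `F n` does so with l_n going to c_n,
because c_n = l_{n+1}/(1 - l_{n+1}). For i = k the latter follow from equivariance.

For i ≠ k they prescribe `F (n+1)` on the faces of Δ_{n+1}: it must induce U ∘ `F n` ∘ (`Z n`)⁻¹
there, where U is induced by `Z (n+1)` between the slices x_j = l_{n+1} and x_j = l_{n+2}. So `F` is
built by recursion on n, and each step is an extension problem. Its boundary map scales l_{n+1} to
l_n, to c_n, to c_{n+1}, as `F (n+1)` should. Coning the boundary map directly would not keep this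
scaling inside the simplex. Hence an explicit P = Λ(kink) with the right scaling is split off. What
remains on the faces fixes all coordinates up to c_{n+1}, and the cone from the barycenter preserves
that property (`cone_apply_of_le`, `IsComfortable.exists_extension`). Then P followed by the cone is
`F (n+1)` (`exists_thetaOne_succ`).

The cross statement is the scaling property of `F n`. The chain complex follows from the face
equation, as the weights m_i m_k are symmetric. -/

/-! ### Equivariant, order-preserving homeomorphisms and scaling of small coordinates -/

/-- A self-homeomorphism of a simplex that is equivariant under permutations of the coordinates
and reflects and preserves the order between coordinates. -/
structure IsComfortable (F : Simplex n ≃ₜ Simplex n) : Prop where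
  equivariant : RespectsPermutations F
  le_iff : ∀ x i j, F x i ≤ F x j ↔ x i ≤ x j

theorem IsComfortable.mem_comfort {F : Simplex n ≃ₜ Simplex n} (h : IsComfortable F) :
    F ∈ Comfort n :=
  ⟨h.equivariant, fun x _ hσ _ _ hab => (h.le_iff x _ _).2 (hσ hab)⟩

theorem IsComfortable.refl : IsComfortable (Homeomorph.refl (Simplex n)) :=
  ⟨fun _ _ _ h => h, fun _ _ _ => Iff.rfl⟩

theorem IsComfortable.trans {F G : Simplex n ≃ₜ Simplex n} (hF : IsComfortable F)
    (hG : IsComfortable G) : IsComfortable (F.trans G) :=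
  ⟨fun σ x x' h => hG.equivariant σ (F x) (F x') (hF.equivariant σ x x' h),
    fun x i j => (hG.le_iff (F x) i j).trans (hF.le_iff x i j)⟩

/-- The point of a simplex with permuted coordinates. -/
def permute (σ : Equiv.Perm (Fin (n + 1))) (x : Simplex n) : Simplex n :=
  ⟨fun l => x (σ l), fun l => x.2.1 (σ l), (Equiv.sum_comp σ (fun l => x l)).trans x.2.2⟩

@[simp]
theorem permute_apply (σ : Equiv.Perm (Fin (n + 1))) (x : Simplex n) (l : Fin (n + 1)) :
    permute σ x l = x (σ l) := rfl

theorem IsComfortable.symm {F : Simplex n ≃ₜ Simplex n} (h : IsComfortable F) :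
    IsComfortable F.symm := by
  refine ⟨fun σ x x' hx l => ?_, fun x i j => ?_⟩
  · have : F (permute σ (F.symm x)) = x' := by
      ext l
      rw [h.equivariant σ (F.symm x) _ (fun _ => rfl) l, hx l, F.apply_symm_apply]
    rw [← this, F.symm_apply_apply, permute_apply]
  · rw [← h.le_iff, F.apply_symm_apply]

/-- `F` multiplies the coordinates that are at most `a` by `b / a`, and moves the coordinates above
`a` to values above `b`. -/
structure ScalesBelow (F : Simplex n → Simplex n) (a b : ℝ) : Prop where
  eq_mul : ∀ x i, x i ≤ a → F x i = b / a * x i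
  lt : ∀ x i, a < x i → b < F x i

theorem ScalesBelow.le_iff {F : Simplex n → Simplex n} {a b : ℝ} (h : ScalesBelow F a b)
    (ha : 0 < a) (hb : 0 < b) (x : Simplex n) (i : Fin (n + 1)) : F x i ≤ b ↔ x i ≤ a := by
  refine ⟨fun hx => not_lt.1 fun hlt => (h.lt x i hlt).not_ge hx, fun hx => ?_⟩
  rw [h.eq_mul x i hx]
  calc b / a * x i ≤ b / a * a := by gcongr
    _ = b := by field_simp

/-- With t = 0 this says that faces go to faces, with t = a that the a-cross goes to the b-cross. -/
theorem ScalesBelow.eq_iff {F : Simplex n → Simplex n} {a b : ℝ} (h : ScalesBelow F a b)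
    (ha : 0 < a) (hb : 0 < b) {t : ℝ} (ht : t ≤ a) (x : Simplex n) (i : Fin (n + 1)) :
    F x i = b / a * t ↔ x i = t := by
  constructor
  · intro hx
    have h1 : x i ≤ a := by
      rw [← h.le_iff ha hb, hx]
      calc b / a * t ≤ b / a * a := by gcongr
        _ = b := by field_simp
    rw [h.eq_mul x i h1] at hx
    exact mul_left_cancel₀ (div_pos hb ha).ne' hx
  · rintro rfl
    exact h.eq_mul x i ht

theorem ScalesBelow.trans {F G : Simplex n ≃ₜ Simplex n} {a b c : ℝ} (hF : ScalesBelow F a b)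
    (hG : ScalesBelow G b c) (ha : 0 < a) (hb : 0 < b) : ScalesBelow (F.trans G) a c := by
  refine ⟨fun x i hx => ?_, fun x i hx => hG.lt _ _ (hF.lt x i hx)⟩
  rw [Homeomorph.trans_apply, hG.eq_mul _ _ ((hF.le_iff ha hb x i).2 hx), hF.eq_mul x i hx]
  field_simp

theorem ScalesBelow.symm {F : Simplex n ≃ₜ Simplex n} {a b : ℝ} (h : ScalesBelow F a b)
    (ha : 0 < a) (hb : 0 < b) : ScalesBelow F.symm b a := by
  refine ⟨fun x i hx => ?_, fun x i hx => ?_⟩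
  · rw [← F.apply_symm_apply x, h.le_iff ha hb] at hx
    have := h.eq_mul _ i hx
    rw [F.apply_symm_apply] at this
    rw [this]
    field_simp
  · rw [← not_le, ← h.le_iff ha hb, F.apply_symm_apply]
    exact not_le.2 hx

/-! ### Slices of the simplex and the maps induced on them -/

/-- The map `Δ_n → Δ_{n+1}` that inserts the coordinate `a` at position `j` and multiplies the
other coordinates by `1 - a`. -/
def insertCoord (a : unitInterval) (j : Fin (n + 2)) (x : Simplex n) : Simplex (n + 1) :=
  ⟨j.insertNth (α := fun _ => ℝ) (a : ℝ) (fun k => (1 - (a : ℝ)) * x k), by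
    refine ⟨fun k => ?_, ?_⟩
    · refine Fin.succAboveCases j ?_ (fun l => ?_) k
      · simpa using a.2.1
      · simp only [Fin.insertNth_apply_succAbove]
        exact mul_nonneg (sub_nonneg.mpr a.2.2) (x.2.1 l)
    · rw [Fin.sum_univ_succAbove _ j]
      simp only [Fin.insertNth_apply_same, Fin.insertNth_apply_succAbove]
      rw [← Finset.mul_sum, stdSimplex.sum_eq_one x]
      ring⟩

@[simp]
theorem insertCoord_same (a : unitInterval) (j : Fin (n + 2)) (x : Simplex n) :
    insertCoord a j x j = a := by
  change (insertCoord a j x).1 j = a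
  simp only [insertCoord, Fin.insertNth_apply_same]

@[simp]
theorem insertCoord_succAbove (a : unitInterval) (j : Fin (n + 2)) (x : Simplex n)
    (k : Fin (n + 1)) : insertCoord a j x (j.succAbove k) = (1 - a) * x k := by
  change (insertCoord a j x).1 (j.succAbove k) = _
  simp only [insertCoord, Fin.insertNth_apply_succAbove]

theorem faceMap_eq_insertCoord (L n : ℕ) (i : Fin (L + 1)) (j : Fin (n + 2)) (x : Simplex n) :
    faceMap L n i j x = insertCoord ⟨height L (n + 1) i, height_nonneg L (n + 1) i,
      height_le_one L (n + 1) i⟩ j x := rfl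

theorem continuous_coord (k : Fin (n + 1)) : Continuous fun x : Simplex n => x k :=
  (continuous_apply k).comp continuous_subtype_val

theorem continuous_of_coord {Y : Type*} [TopologicalSpace Y] {f : Y → Simplex n}
    (h : ∀ k, Continuous fun y => f y k) : Continuous f :=
  continuous_induced_rng.2 (continuous_pi h)

theorem ext_succAbove {x y : Simplex (n + 1)} (j : Fin (n + 2)) (h : x j = y j)
    (h' : ∀ k, x (j.succAbove k) = y (j.succAbove k)) : x = y := by
  ext l
  exact Fin.succAboveCases j h h' l

theorem continuous_insertCoord (a : unitInterval) (j : Fin (n + 2)) :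
    Continuous (insertCoord (n := n) a j) := by
  refine continuous_of_coord fun k => ?_
  refine Fin.succAboveCases j ?_ (fun l => ?_) k
  · simpa using continuous_const
  · simp only [insertCoord_succAbove]
    exact continuous_const.mul (continuous_coord l)

theorem insertCoord_injective {a : unitInterval} (ha : (a : ℝ) < 1) (j : Fin (n + 2)) :
    Function.Injective (insertCoord (n := n) a j) := by
  intro x y h
  ext k
  have := congrArg (fun z : Simplex (n + 1) => z (j.succAbove k)) h
  simp only [insertCoord_succAbove] at this
  exact mul_left_cancel₀ (sub_pos.2 ha).ne' this

theorem exists_eq_insertCoord {a : unitInterval} (ha : (a : ℝ) < 1) {j : Fin (n + 2)}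
    {z : Simplex (n + 1)} (hz : z j = a) : ∃ x, z = insertCoord a j x := by
  have ha' := sub_pos.2 ha
  refine ⟨⟨fun k => z (j.succAbove k) / (1 - a), fun k => div_nonneg (z.2.1 _) ha'.le, ?_⟩, ?_⟩
  · have := stdSimplex.sum_eq_one z
    rw [Fin.sum_univ_succAbove _ j, hz] at this
    rw [← Finset.sum_div, div_eq_one_iff_eq ha'.ne']
    linarith
  · refine ext_succAbove j (by simpa using hz) fun k => ?_
    rw [insertCoord_succAbove]
    exact (mul_div_cancel₀ _ ha'.ne').symm

/-- The permutation that sends `j` to `j'` and acts on the complements of `j` and `j'` as `σ`. -/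
def extendPerm (j j' : Fin (n + 2)) (σ : Equiv.Perm (Fin (n + 1))) : Equiv.Perm (Fin (n + 2)) :=
  (finSuccEquiv' j).trans ((Equiv.optionCongr σ).trans (finSuccEquiv' j').symm)

@[simp]
theorem extendPerm_self (j j' : Fin (n + 2)) (σ : Equiv.Perm (Fin (n + 1))) :
    extendPerm j j' σ j = j' := by
  simp [extendPerm]

@[simp]
theorem extendPerm_succAbove (j j' : Fin (n + 2)) (σ : Equiv.Perm (Fin (n + 1)))
    (k : Fin (n + 1)) : extendPerm j j' σ (j.succAbove k) = j'.succAbove (σ k) := by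
  simp [extendPerm]

theorem insertCoord_extendPerm (a : unitInterval) (j j' : Fin (n + 2))
    (σ : Equiv.Perm (Fin (n + 1))) {x x' : Simplex n} (h : ∀ k, x' k = x (σ k)) (l : Fin (n + 2)) :
    insertCoord a j x' l = insertCoord a j' x (extendPerm j j' σ l) := by
  refine Fin.succAboveCases j ?_ (fun k => ?_) l
  · simp
  · simp [h k]

theorem exists_perm_succAbove (τ : Equiv.Perm (Fin (n + 2))) (j : Fin (n + 2)) :
    ∃ σ : Equiv.Perm (Fin (n + 1)), τ = extendPerm j (τ j) σ := by
  have h : ∀ k, ∃ k', (τ j).succAbove k' = τ (j.succAbove k) := fun k =>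
    Fin.exists_succAbove_eq fun h => Fin.succAbove_ne j k (τ.injective h)
  choose f hf using h
  have hinj : Function.Injective f := fun k k' hk => by
    have := hf k
    rw [hk, hf k'] at this
    exact (Fin.succAbove_right_injective (τ.injective this)).symm
  refine ⟨Equiv.ofBijective f (Finite.injective_iff_bijective.1 hinj), Equiv.ext fun l => ?_⟩
  refine Fin.succAboveCases j ?_ (fun k => ?_) l
  · simp
  · simp [hf k]

/-- A comfortable homeomorphism that maps each set `{x | x j = a}` onto `{x | x j = b}` induces a
comfortable homeomorphism of the simplex of one dimension less. -/
theorem IsComfortable.exists_restrict {F : Simplex (n + 1) ≃ₜ Simplex (n + 1)}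
    (hF : IsComfortable F) {a b : unitInterval} (ha : (a : ℝ) < 1) (hb : (b : ℝ) < 1)
    (hab : ∀ x j, F x j = b ↔ x j = a) :
    ∃ F' : Simplex n ≃ₜ Simplex n, IsComfortable F' ∧
      ∀ j x, F (insertCoord a j x) = insertCoord b j (F' x) := by
  have h : ∀ x : Simplex n, ∃ y, F (insertCoord a 0 x) = insertCoord b 0 y := fun x =>
    exists_eq_insertCoord hb ((hab _ _).2 (insertCoord_same a 0 x))
  choose f hf using h
  have hcont : Continuous f := by
    rw [((continuous_insertCoord b 0).isClosedEmbedding (insertCoord_injective hb 0)).continuous_iff]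
    simpa only [Function.comp_def, ← hf] using F.continuous.comp (continuous_insertCoord a 0)
  have hbij : Function.Bijective f := by
    refine ⟨fun x y hxy => ?_, fun y => ?_⟩
    · apply insertCoord_injective ha 0
      apply F.injective
      rw [hf, hf, hxy]
    · obtain ⟨x, hx⟩ := exists_eq_insertCoord (z := F.symm (insertCoord b 0 y)) (j := 0) ha
        ((hab _ _).1 (by simp))
      refine ⟨x, insertCoord_injective hb 0 ?_⟩
      rw [← hf, ← hx, F.apply_symm_apply]
  -- The map `f` was defined through the slice at position 0; equivariance shows that every position
  -- induces the same map.
  have hspec : ∀ j x, F (insertCoord a j x) = insertCoord b j (f x) := by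
    intro j x
    ext l
    rw [hF.equivariant (extendPerm j 0 1) (insertCoord a 0 x) _
      (insertCoord_extendPerm a j 0 1 fun _ => rfl), hf]
    exact (insertCoord_extendPerm b j 0 1 (fun _ => rfl) l).symm
  have hb' := sub_pos.2 hb
  have hcoord : ∀ x k, F (insertCoord a 0 x) (Fin.succAbove 0 k) = (1 - b) * f x k := fun x k => by
    rw [hf, insertCoord_succAbove]
  refine ⟨IsHomeomorph.homeomorph f (isHomeomorph_iff_continuous_bijective.2 ⟨hcont, hbij⟩),
    ⟨fun σ x x' hx l => ?_, fun x i j => ?_⟩, hspec⟩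
  · apply mul_left_cancel₀ hb'.ne'
    change (1 - (b : ℝ)) * f x' l = (1 - b) * f x (σ l)
    rw [← hcoord, ← hcoord, hF.equivariant _ _ _ (insertCoord_extendPerm a 0 0 σ hx),
      extendPerm_succAbove]
  · change f x i ≤ f x j ↔ _
    rw [← mul_le_mul_iff_right₀ hb', ← hcoord, ← hcoord, hF.le_iff, insertCoord_succAbove,
      insertCoord_succAbove, mul_le_mul_iff_right₀ (sub_pos.2 ha)]

/-- Insertion of a shrinks the other coordinates by 1 - a, so thresholds grow by the inverse factor.
-/
theorem ScalesBelow.restrict {F : Simplex (n + 1) → Simplex (n + 1)} {F' : Simplex n → Simplex n}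
    {a b : unitInterval} (ha : (a : ℝ) < 1) (hb : (b : ℝ) < 1) {A B : ℝ}
    (h : ScalesBelow F A B)
    (hF' : ∀ j x, F (insertCoord a j x) = insertCoord b j (F' x)) :
    ScalesBelow F' (A / (1 - a)) (B / (1 - b)) := by
  have ha' := sub_pos.2 ha
  have hb' := sub_pos.2 hb
  have key : ∀ x i, F (insertCoord a 0 x) (Fin.succAbove 0 i) = (1 - b) * F' x i := fun x i => by
    rw [hF', insertCoord_succAbove]
  refine ⟨fun x i hx => ?_, fun x i hx => ?_⟩
  · have h1 := h.eq_mul (insertCoord a 0 x) (Fin.succAbove 0 i) (by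
      rw [insertCoord_succAbove, mul_comm]
      exact (le_div_iff₀ ha').1 hx)
    rw [key, insertCoord_succAbove] at h1
    rw [← mul_div_cancel_left₀ (F' x i) hb'.ne', h1]
    field_simp
  · have h1 := h.lt (insertCoord a 0 x) (Fin.succAbove 0 i) (by
      rw [insertCoord_succAbove, mul_comm]
      exact (div_lt_iff₀ ha').1 hx)
    rw [key, mul_comm] at h1
    exact (div_lt_iff₀ hb').2 h1

/-! ### Coning from the barycenter -/

/-- The point that divides the segment from the barycenter of `Δ_{n+1}` to the point `w` of its
`j`-th face in the ratio `s : 1 - s`. -/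
def conePoint (j : Fin (n + 2)) (s : unitInterval) (w : Simplex n) : Simplex (n + 1) :=
  ⟨fun l => (1 - s) * (1 / ((n : ℝ) + 2)) + s * insertCoord 0 j w l, by
    refine ⟨fun l => ?_, ?_⟩
    · have h1 := sub_nonneg.2 s.2.2
      have h2 := s.2.1
      have h3 := stdSimplex.zero_le (insertCoord 0 j w) l
      positivity
    · rw [Finset.sum_add_distrib, ← Finset.mul_sum, ← Finset.mul_sum, stdSimplex.sum_eq_one]
      simp only [Finset.sum_const, Finset.card_univ, Fintype.card_fin, nsmul_eq_mul]
      push_cast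
      field_simp
      ring⟩

theorem conePoint_apply (j : Fin (n + 2)) (s : unitInterval) (w : Simplex n) (l : Fin (n + 2)) :
    conePoint j s w l = (1 - s) * (1 / ((n : ℝ) + 2)) + s * insertCoord 0 j w l := rfl

theorem conePoint_same (j : Fin (n + 2)) (s : unitInterval) (w : Simplex n) :
    conePoint j s w j = (1 - s) * (1 / ((n : ℝ) + 2)) := by
  simp [conePoint_apply]

theorem conePoint_succAbove (j : Fin (n + 2)) (s : unitInterval) (w : Simplex n)
    (k : Fin (n + 1)) :
    conePoint j s w (j.succAbove k) = (1 - s) * (1 / ((n : ℝ) + 2)) + s * w k := by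
  simp [conePoint_apply]

theorem conePoint_one (j : Fin (n + 2)) (w : Simplex n) :
    conePoint j 1 w = insertCoord 0 j w := by
  ext l
  simp [conePoint_apply]

theorem conePoint_extendPerm (j j' : Fin (n + 2)) (s : unitInterval)
    (σ : Equiv.Perm (Fin (n + 1))) {x x' : Simplex n} (h : ∀ k, x' k = x (σ k)) (l : Fin (n + 2)) :
    conePoint j s x' l = conePoint j' s x (extendPerm j j' σ l) := by
  rw [conePoint_apply, conePoint_apply, insertCoord_extendPerm 0 j j' σ h]

theorem continuous_conePoint :
    Continuous fun p : Fin (n + 2) × unitInterval × Simplex n => conePoint p.1 p.2.1 p.2.2 := by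
  rw [continuous_prod_of_discrete_left]
  intro j
  refine continuous_of_coord fun k => ?_
  simp only [conePoint_apply]
  have h : Continuous fun p : unitInterval × Simplex n => insertCoord 0 j p.2 k :=
    (continuous_coord k).comp ((continuous_insertCoord 0 j).comp continuous_snd)
  fun_prop

/-- Take j to be the position of a minimal coordinate; coordinate j of a cone point is (1 -
s)/(n+2), which forces s = 1 - (n+2) x_j. -/
theorem exists_eq_conePoint (x : Simplex (n + 1)) :
    ∃ p : Fin (n + 2) × unitInterval × Simplex n, conePoint p.1 p.2.1 p.2.2 = x := by
  obtain ⟨j, hj⟩ := Finite.exists_min x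
  have hn : (0 : ℝ) < (n : ℝ) + 2 := by positivity
  have hsum := stdSimplex.sum_eq_one x
  have hle : ((n : ℝ) + 2) * x j ≤ 1 := by
    have : ∑ _l : Fin (n + 2), x j ≤ 1 := hsum ▸ Finset.sum_le_sum fun l _ => hj l
    simpa using this
  rw [Fin.sum_univ_succAbove _ j] at hsum
  set s : unitInterval := ⟨1 - ((n : ℝ) + 2) * x j, by linarith, by
    have := mul_nonneg hn.le (stdSimplex.zero_le x j); linarith⟩ with hs
  have hsv : (s : ℝ) = 1 - ((n : ℝ) + 2) * x j := rfl
  have hm : (1 - (s : ℝ)) * (1 / ((n : ℝ) + 2)) = x j := by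
    rw [hsv]; field_simp; ring
  have hd : ∑ k, (x (j.succAbove k) - x j) = s := by
    rw [Finset.sum_sub_distrib]
    simp only [Finset.sum_const, Finset.card_univ, Fintype.card_fin, nsmul_eq_mul]
    push_cast
    rw [hsv]
    linarith
  rcases eq_or_ne (s : ℝ) 0 with h0 | h0
  · have hz : ∀ k, x (j.succAbove k) - x j = 0 := fun k =>
      (Finset.sum_eq_zero_iff_of_nonneg fun k _ => sub_nonneg.2 (hj _)).1 (hd.trans h0) k
        (Finset.mem_univ k)
    -- Here x is the barycenter and any point of the face serves; a vertex is chosen.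
    refine ⟨(j, s, ⟨Pi.single 0 1, single_mem_stdSimplex ℝ 0⟩), ext_succAbove j ?_ fun k => ?_⟩
    · rw [conePoint_same, hm]
    · rw [conePoint_succAbove, hm, h0]
      have := hz k
      linarith
  · have hpos : (0 : ℝ) < s := lt_of_le_of_ne s.2.1 (Ne.symm h0)
    refine ⟨(j, s, ⟨fun k => (x (j.succAbove k) - x j) / s,
      fun k => div_nonneg (sub_nonneg.2 (hj _)) hpos.le, ?_⟩), ext_succAbove j ?_ fun k => ?_⟩
    · rw [← Finset.sum_div, hd, div_self h0]
    · rw [conePoint_same, hm]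
    · rw [conePoint_succAbove, hm]
      change x j + s * ((x (j.succAbove k) - x j) / s) = _
      field_simp
      ring

/-- Both sides have the same minimal coordinate, and it determines s. -/
theorem conePoint_param_eq {j j' : Fin (n + 2)} {s s' : unitInterval} {w w' : Simplex n}
    (h : conePoint j s w = conePoint j' s' w') : s = s' := by
  have hge : ∀ (j : Fin (n + 2)) (s : unitInterval) (w : Simplex n) l,
      (1 - s) * (1 / ((n : ℝ) + 2)) ≤ conePoint j s w l := fun j s w l => by
    have := mul_nonneg s.2.1 (stdSimplex.zero_le (insertCoord 0 j w) l)
    rw [conePoint_apply]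
    linarith
  have h1 := hge j s w j'
  rw [h, conePoint_same] at h1
  have h2 := hge j' s' w' j
  rw [← h, conePoint_same] at h2
  have hn : (0 : ℝ) < 1 / ((n : ℝ) + 2) := by positivity
  have h3 := mul_right_cancel₀ hn.ne' (le_antisymm h1 h2)
  exact Subtype.ext (by linarith)

theorem conePoint_zero (j j' : Fin (n + 2)) (w w' : Simplex n) :
    conePoint j 0 w = conePoint j' 0 w' := by
  ext l
  simp [conePoint_apply]

theorem conePoint_injective (j : Fin (n + 2)) {s : unitInterval} (hs : s ≠ 0) :
    Function.Injective (conePoint (n := n) j s) := by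
  intro x y h
  ext k
  have := congrArg (fun z : Simplex (n + 1) => z (j.succAbove k)) h
  simp only [conePoint_succAbove, add_right_inj] at this
  exact mul_left_cancel₀ (fun h => hs (Subtype.ext h)) this

/-- The coned map is well defined. Two different positions j, j' can occur for one point with s ≠ 0
only if both coordinates are minimal. Then w has a zero at the place of j', the transposition of j
and j' fixes the point, and, since `f` keeps zeros, it also fixes the image. -/
theorem conePoint_eq_of_eq {f : Simplex n → Simplex n} (hf : RespectsPermutations f)
    (h0 : ∀ x k, x k = 0 → f x k = 0) {j j' : Fin (n + 2)} {s s' : unitInterval}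
    {w w' : Simplex n} (h : conePoint j s w = conePoint j' s' w') :
    conePoint j s (f w) = conePoint j' s' (f w') := by
  obtain rfl := conePoint_param_eq h
  rcases eq_or_ne s 0 with rfl | hs
  · exact conePoint_zero _ _ _ _
  rcases eq_or_ne j' j with rfl | hj
  · rw [conePoint_injective _ hs h]
  have hs' : (s : ℝ) ≠ 0 := fun h => hs (Subtype.ext h)
  obtain ⟨k₀, rfl⟩ := Fin.exists_succAbove_eq hj
  set j' := j.succAbove k₀ with hj'
  have hw : w k₀ = 0 := by
    have := conePoint_same j' s w'
    rw [← h, hj', conePoint_succAbove] at this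
    exact (mul_eq_zero.1 (by linarith)).resolve_left hs'
  have hswap : ∀ v : Simplex n, v k₀ = 0 → ∀ l,
      conePoint j s v (Equiv.swap j' j l) = conePoint j s v l := fun v hv l => by
    have heq : conePoint j s v j' = conePoint j s v j := by
      rw [hj', conePoint_succAbove, conePoint_same, hv]; ring
    rcases eq_or_ne l j' with rfl | h1
    · rw [Equiv.swap_apply_left, heq]
    rcases eq_or_ne l j with rfl | h2
    · rw [Equiv.swap_apply_right, heq]
    · rw [Equiv.swap_apply_of_ne_of_ne h1 h2]
  obtain ⟨σ, hσ⟩ := exists_perm_succAbove (Equiv.swap j' j) j'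
  rw [Equiv.swap_apply_left] at hσ
  have hw' : w' = permute σ w := by
    apply conePoint_injective j' hs
    rw [← h]
    ext l
    rw [conePoint_extendPerm j' j s σ (fun _ => rfl) l, ← hσ, hswap w hw]
  ext l
  rw [conePoint_extendPerm j' j s σ (hf σ w w' (by rw [hw']; exact fun _ => rfl)) l, ← hσ,
    hswap _ (h0 w k₀ hw)]

theorem exists_continuous_cone {f : Simplex n → Simplex n} (hc : Continuous f)
    (hf : RespectsPermutations f) (h0 : ∀ x k, x k = 0 → f x k = 0) :
    ∃ g : Simplex (n + 1) → Simplex (n + 1), Continuous g ∧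
      ∀ j s w, g (conePoint j s w) = conePoint j s (f w) := by
  choose p hp using exists_eq_conePoint (n := n)
  have hg : ∀ j s w, conePoint (p (conePoint j s w)).1 (p (conePoint j s w)).2.1
      (f (p (conePoint j s w)).2.2) = conePoint j s (f w) := fun j s w =>
    conePoint_eq_of_eq hf h0 (hp (conePoint j s w))
  refine ⟨fun x => conePoint (p x).1 (p x).2.1 (f (p x).2.2), ?_, hg⟩
  -- The parametrization is a continuous surjection from a compact space to a Hausdorff one, hence a
  -- quotient map.
  rw [(Topology.IsQuotientMap.of_surjective_continuous exists_eq_conePoint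
    continuous_conePoint).continuous_iff]
  have : Continuous fun q : Fin (n + 2) × unitInterval × Simplex n =>
      conePoint q.1 q.2.1 (f q.2.2) :=
    continuous_conePoint.comp (continuous_fst.prodMk
      (continuous_snd.fst.prodMk (hc.comp continuous_snd.snd)))
  exact this.congr fun q => (hg q.1 q.2.1 q.2.2).symm

/-- A comfortable homeomorphism of `Δ_n` that respects the faces extends from the faces of
`Δ_{n+1}` to `Δ_{n+1}` by coning from the barycenter. -/
theorem IsComfortable.exists_cone {F : Simplex n ≃ₜ Simplex n} (hF : IsComfortable F)
    (h0 : ∀ x k, F x k = 0 ↔ x k = 0) :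
    ∃ G : Simplex (n + 1) ≃ₜ Simplex (n + 1), IsComfortable G ∧
      ∀ j s w, G (conePoint j s w) = conePoint j s (F w) := by
  obtain ⟨g, hgc, hg⟩ := exists_continuous_cone F.continuous hF.equivariant fun x k => (h0 x k).2
  obtain ⟨g', hgc', hg'⟩ := exists_continuous_cone F.symm.continuous hF.symm.equivariant
    fun x k hx => (h0 _ k).1 (by rwa [F.apply_symm_apply])
  let G : Simplex (n + 1) ≃ₜ Simplex (n + 1) :=
    { toFun := g
      invFun := g'
      left_inv := fun x => by
        obtain ⟨⟨j, s, w⟩, rfl⟩ := exists_eq_conePoint x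
        rw [hg, hg', F.symm_apply_apply]
      right_inv := fun x => by
        obtain ⟨⟨j, s, w⟩, rfl⟩ := exists_eq_conePoint x
        rw [hg', hg, F.apply_symm_apply]
      continuous_toFun := hgc
      continuous_invFun := hgc' }
  have hG : ∀ j s w, G (conePoint j s w) = conePoint j s (F w) := hg
  refine ⟨G, ⟨fun τ x x' hx l => ?_, fun x l l' => ?_⟩, hG⟩
  · obtain ⟨⟨j, s, w⟩, rfl⟩ := exists_eq_conePoint x
    obtain ⟨σ, hσ⟩ := exists_perm_succAbove τ (τ.symm j)
    rw [τ.apply_symm_apply] at hσ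
    have hx' : x' = conePoint (τ.symm j) s (permute σ w) := by
      ext l
      rw [hx, conePoint_extendPerm (τ.symm j) j s σ (fun _ => rfl) l, ← hσ]
    rw [hx', hG, hG, conePoint_extendPerm (τ.symm j) j s σ
      (hF.equivariant σ w _ fun _ => rfl) l, ← hσ]
  · obtain ⟨⟨j, s, w⟩, rfl⟩ := exists_eq_conePoint x
    dsimp only
    rw [hG]
    rcases eq_or_ne s 0 with rfl | hs
    · simp [conePoint_apply]
    have hs' : (0 : ℝ) < s := lt_of_le_of_ne s.2.1 fun h => hs (Subtype.ext h.symm)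
    simp only [conePoint_apply, add_le_add_iff_left, mul_le_mul_iff_right₀ hs']
    refine Fin.succAboveCases j ?_ (fun k => ?_) l <;>
      refine Fin.succAboveCases j ?_ (fun k' => ?_) l'
    · simp
    · simp [stdSimplex.zero_le]
    -- Comparison with the minimal coordinate j, where equality means that w vanishes at k; `h0`
    -- transfers this to the image.
    · have hz : ∀ v : Simplex n, v k ≤ 0 ↔ v k = 0 := fun v =>
        ⟨fun h => le_antisymm h (stdSimplex.zero_le v k), fun h => h.le⟩
      simp [hz, h0]
    · simp [hF.le_iff]

/-- A coordinate of a cone point is a convex combination of 1/(n+2) ≥ α and a coordinate of w. If it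
is at most α and s ≠ 0, then so is that of w, which `F` fixes. -/
theorem cone_apply_of_le {F : Simplex n → Simplex n} {G : Simplex (n + 1) → Simplex (n + 1)}
    (hG : ∀ j s w, G (conePoint j s w) = conePoint j s (F w)) {α : ℝ} (hα : α ≤ 1 / ((n : ℝ) + 2))
    (hF : ∀ x k, x k ≤ α → F x k = x k) (x : Simplex (n + 1)) (l : Fin (n + 2)) (hx : x l ≤ α) :
    G x l = x l := by
  obtain ⟨⟨j, s, w⟩, rfl⟩ := exists_eq_conePoint x
  dsimp only at hx ⊢
  rw [hG]
  rcases Fin.eq_self_or_eq_succAbove j l with rfl | ⟨k, rfl⟩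
  · rw [conePoint_same, conePoint_same]
  rw [conePoint_succAbove] at hx ⊢
  rw [conePoint_succAbove]
  rcases eq_or_ne s 0 with rfl | hs
  · simp
  have hs' : (0 : ℝ) < s := lt_of_le_of_ne s.2.1 fun h => hs (Subtype.ext h.symm)
  rw [hF w k]
  have h1 := mul_le_mul_of_nonneg_left hα (sub_nonneg.2 s.2.2)
  refine le_of_mul_le_mul_left ?_ hs'
  linarith

/-! ### The maps Λ_n(f) -/

/-- The total excess over `1 / (n + 1)` of the coordinates of `x`. -/
def excess (n : ℕ) (x : Fin (n + 1) → ℝ) : ℝ :=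
  ∑ i, if x i ≤ 1 / ((n : ℝ) + 1) then 0 else x i - 1 / ((n : ℝ) + 1)

/-- The total amount by which the values `f (x i)` fall short of `1 / (n + 1)`, where `i` ranges
over the coordinates with `x i ≤ 1 / (n + 1)`. -/
def deficit (n : ℕ) (f : ℝ → ℝ) (x : Fin (n + 1) → ℝ) : ℝ :=
  ∑ i, if x i ≤ 1 / ((n : ℝ) + 1) then 1 / ((n : ℝ) + 1) - f (x i) else 0

theorem sum_sub_barycenter (x : Simplex n) : ∑ i, (x i - 1 / ((n : ℝ) + 1)) = 0 := by
  rw [Finset.sum_sub_distrib, stdSimplex.sum_eq_one]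
  simp only [Finset.sum_const, Finset.card_univ, Fintype.card_fin, nsmul_eq_mul]
  push_cast
  field_simp
  ring

/-- The deviations of the coordinates from their mean 1/(n+1) sum to zero. -/
theorem deficit_id (x : Simplex n) : deficit n id x = excess n x := by
  rw [← sub_eq_zero, ← neg_eq_zero, ← sum_sub_barycenter x, deficit, excess,
    ← Finset.sum_sub_distrib, ← Finset.sum_neg_distrib]
  refine Finset.sum_congr rfl fun i _ => ?_
  split_ifs <;> simp

theorem sub_le_excess (x : Fin (n + 1) → ℝ) (i : Fin (n + 1)) :
    x i - 1 / ((n : ℝ) + 1) ≤ excess n x := by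
  refine le_trans ?_ (Finset.single_le_sum (f := fun i => if x i ≤ 1 / ((n : ℝ) + 1) then 0
    else x i - 1 / ((n : ℝ) + 1)) (fun j _ => ?_) (Finset.mem_univ i))
  · split_ifs with h
    · exact sub_nonpos.2 h
    · exact le_rfl
  · split_ifs with h
    · exact le_rfl
    · exact (sub_pos.2 (not_le.1 h)).le

theorem excess_eq_sum_max (x : Fin (n + 1) → ℝ) :
    excess n x = ∑ i, max (x i - 1 / ((n : ℝ) + 1)) 0 := by
  refine Finset.sum_congr rfl fun i _ => ?_
  split_ifs with h
  · rw [max_eq_right (sub_nonpos.2 h)]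
  · rw [max_eq_left (sub_pos.2 (not_le.1 h)).le]

theorem excess_nonneg (x : Fin (n + 1) → ℝ) : 0 ≤ excess n x := by
  rw [excess_eq_sum_max]
  exact Finset.sum_nonneg fun i _ => le_max_right _ _

theorem apply_le_barycenter_iff {e : ℝ ≃o ℝ}
    (he : e (1 / ((n : ℝ) + 1)) = 1 / ((n : ℝ) + 1)) (t : ℝ) :
    e t ≤ 1 / ((n : ℝ) + 1) ↔ t ≤ 1 / ((n : ℝ) + 1) := by
  conv_lhs => rw [← he]
  exact e.le_iff_le

theorem deficit_eq_sum_max {e : ℝ ≃o ℝ}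
    (he : e (1 / ((n : ℝ) + 1)) = 1 / ((n : ℝ) + 1)) (x : Fin (n + 1) → ℝ) :
    deficit n e x = ∑ i, max (1 / ((n : ℝ) + 1) - e (x i)) 0 := by
  refine Finset.sum_congr rfl fun i _ => ?_
  simp only [← apply_le_barycenter_iff he (x i)]
  split_ifs with h
  · rw [max_eq_left (sub_nonneg.2 h)]
  · rw [max_eq_right (sub_nonpos.2 (not_le.1 h).le)]

theorem deficit_nonneg {e : ℝ ≃o ℝ}
    (he : e (1 / ((n : ℝ) + 1)) = 1 / ((n : ℝ) + 1)) (x : Fin (n + 1) → ℝ) : 0 ≤ deficit n e x := by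
  rw [deficit_eq_sum_max he]
  exact Finset.sum_nonneg fun i _ => le_max_right _ _

theorem deficit_eq_zero_iff {e : ℝ ≃o ℝ}
    (he : e (1 / ((n : ℝ) + 1)) = 1 / ((n : ℝ) + 1)) (x : Simplex n) : deficit n e x = 0 ↔ excess n x = 0 := by
  have hid : deficit n (OrderIso.refl ℝ) x = excess n x := deficit_id x
  rw [← hid, deficit_eq_sum_max he, deficit_eq_sum_max (e := OrderIso.refl ℝ) rfl,
    Finset.sum_eq_zero_iff_of_nonneg fun i _ => le_max_right _ _,
    Finset.sum_eq_zero_iff_of_nonneg fun i _ => le_max_right _ _]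
  refine forall₂_congr fun i _ => ?_
  simp only [max_eq_right_iff, sub_nonpos, OrderIso.refl_apply]
  conv_lhs => rw [← he]
  exact e.le_iff_le

theorem deficit_pos {e : ℝ ≃o ℝ}
    (he : e (1 / ((n : ℝ) + 1)) = 1 / ((n : ℝ) + 1)) {x : Simplex n} {i : Fin (n + 1)} (hi : 1 / ((n : ℝ) + 1) < x i) :
    0 < deficit n e x := by
  refine lt_of_le_of_ne (deficit_nonneg he x) fun h => ?_
  rw [eq_comm, deficit_eq_zero_iff he] at h
  have := sub_le_excess x i
  linarith

theorem excess_pos {x : Fin (n + 1) → ℝ} {i : Fin (n + 1)} (hi : 1 / ((n : ℝ) + 1) < x i) :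
    0 < excess n x :=
  (sub_pos.2 hi).trans_le (sub_le_excess x i)

theorem Lambda_of_le {f : ℝ → ℝ} {x : Fin (n + 1) → ℝ} {i : Fin (n + 1)}
    (hi : x i ≤ 1 / ((n : ℝ) + 1)) : Lambda n f x i = f (x i) :=
  if_pos hi

/-- The factor 1 + δ equals deficit/excess. In this form Λ rescales the excess so that it balances
the new deficit. -/
theorem Lambda_of_lt {f : ℝ → ℝ} {x : Simplex n} {i : Fin (n + 1)}
    (hi : 1 / ((n : ℝ) + 1) < x i) :
    Lambda n f x i =
      1 / ((n : ℝ) + 1) + deficit n f x / excess n x * (x i - 1 / ((n : ℝ) + 1)) := by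
  have hD : lambdaD n f x = deficit n f x - excess n x := by
    rw [← deficit_id, lambdaD, deficit, deficit, ← Finset.sum_sub_distrib]
    refine Finset.sum_congr rfl fun i _ => ?_
    split_ifs <;> simp
  have hP := excess_pos hi
  rw [Lambda, if_neg (not_le.2 hi), lambdaDelta, hD, ← excess]
  field_simp
  ring

theorem Lambda_le_iff {e : ℝ ≃o ℝ}
    (he : e (1 / ((n : ℝ) + 1)) = 1 / ((n : ℝ) + 1)) (x : Simplex n) (i : Fin (n + 1)) :
    Lambda n e x i ≤ 1 / ((n : ℝ) + 1) ↔ x i ≤ 1 / ((n : ℝ) + 1) := by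
  rcases le_or_gt (x i) (1 / ((n : ℝ) + 1)) with hi | hi
  · rw [Lambda_of_le hi]
    exact apply_le_barycenter_iff he _
  · refine iff_of_false (not_le.2 ?_) (not_le.2 hi)
    rw [Lambda_of_lt hi]
    have := mul_pos (div_pos (deficit_pos he hi) (excess_pos hi)) (sub_pos.2 hi)
    linarith

theorem excess_Lambda {e : ℝ ≃o ℝ}
    (he : e (1 / ((n : ℝ) + 1)) = 1 / ((n : ℝ) + 1)) (x : Simplex n) : excess n (Lambda n e x) = deficit n e x := by
  have h1 : ∀ r, r = deficit n e x / excess n x → excess n (Lambda n e x) = r * excess n x := by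
    intro r hr
    rw [excess, excess, Finset.mul_sum]
    refine Finset.sum_congr rfl fun i _ => ?_
    simp only [Lambda_le_iff he]
    split_ifs with hi
    · simp
    · rw [Lambda_of_lt (not_le.1 hi), ← hr]
      ring
  rw [h1 _ rfl]
  -- If no coordinate exceeds the mean, the quotient has the default value 0 and both totals vanish.
  exact div_mul_cancel_of_imp fun h => (deficit_eq_zero_iff he x).2 h

theorem Lambda_mem_stdSimplex {e : ℝ ≃o ℝ}
    (he : e (1 / ((n : ℝ) + 1)) = 1 / ((n : ℝ) + 1)) (h0 : e 0 = 0) (x : Simplex n) :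
    Lambda n e x ∈ stdSimplex ℝ (Fin (n + 1)) := by
  refine ⟨fun i => ?_, ?_⟩
  · rcases le_or_gt (x i) (1 / ((n : ℝ) + 1)) with hi | hi
    · rw [Lambda_of_le hi, ← h0]
      exact e.le_iff_le.2 (stdSimplex.zero_le x i)
    · refine le_trans (by positivity) (not_le.1 (mt (Lambda_le_iff he x i).1 (not_le.2 hi))).le
  · have h1 : ∑ i, (Lambda n e x i - 1 / ((n : ℝ) + 1)) =
        excess n (Lambda n e x) - deficit n e x := by
      rw [excess, deficit, ← Finset.sum_sub_distrib]
      refine Finset.sum_congr rfl fun i _ => ?_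
      simp only [Lambda_le_iff he]
      split_ifs with hi
      · rw [Lambda_of_le hi]
        ring
      · ring
    rw [excess_Lambda he, sub_self, Finset.sum_sub_distrib] at h1
    simp only [Finset.sum_const, Finset.card_univ, Fintype.card_fin, nsmul_eq_mul] at h1
    push_cast at h1
    rw [sub_eq_zero.1 h1]
    field_simp

/-- Applying Λ(e) and then Λ(e⁻¹) turns the pair (excess, deficit) around, so the two scaling
factors are reciprocal. -/
theorem Lambda_symm_Lambda {e : ℝ ≃o ℝ}
    (he : e (1 / ((n : ℝ) + 1)) = 1 / ((n : ℝ) + 1)) (h0 : e 0 = 0) (x : Simplex n) :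
    Lambda n e.symm (Lambda n e x) = x := by
  have hmem := Lambda_mem_stdSimplex he h0 x
  have hD : deficit n e.symm (Lambda n e x) = excess n x := by
    rw [← deficit_id, deficit, deficit]
    refine Finset.sum_congr rfl fun i _ => ?_
    simp only [Lambda_le_iff he]
    split_ifs with hi
    · rw [Lambda_of_le hi, e.symm_apply_apply, id]
    · rfl
  ext i
  rcases le_or_gt (x i) (1 / ((n : ℝ) + 1)) with hi | hi
  · rw [Lambda_of_le ((Lambda_le_iff he x i).2 hi), Lambda_of_le hi, e.symm_apply_apply]
  · have h := Lambda_of_lt (f := e.symm) (x := ⟨Lambda n e x, hmem⟩)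
      (not_le.1 (mt (Lambda_le_iff he x i).1 (not_le.2 hi)))
    refine h.trans ?_
    change 1 / ((n : ℝ) + 1) + deficit n e.symm (Lambda n e x) / excess n (Lambda n e x) *
      (Lambda n e x i - 1 / ((n : ℝ) + 1)) = x i
    rw [hD, excess_Lambda he, Lambda_of_lt hi]
    have h1 := deficit_pos he hi
    have h2 := excess_pos hi
    field_simp
    ring

/-- The quotient q/p may be discontinuous at zeros of p, but there 0 ≤ (q/p) m ≤ q squeezes the
product to 0. This handles the barycenter, where excess and deficit vanish. -/
theorem continuous_div_mul_of_le {X : Type*} [TopologicalSpace X] {q p m : X → ℝ}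
    (hq : Continuous q) (hp : Continuous p) (hm : Continuous m) (hq0 : ∀ x, 0 ≤ q x)
    (hm0 : ∀ x, 0 ≤ m x) (hmp : ∀ x, m x ≤ p x) (hpq : ∀ x, p x = 0 → q x = 0) :
    Continuous fun x => q x / p x * m x := by
  refine continuous_iff_continuousAt.2 fun x => ?_
  by_cases hx : p x = 0
  · have hle : ∀ y, q y / p y * m y ≤ q y := fun y => by
      rw [div_mul_eq_mul_div]
      exact div_le_of_le_mul₀ ((hm0 y).trans (hmp y)) (hq0 y)
        (mul_le_mul_of_nonneg_left (hmp y) (hq0 y))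
    have hge : ∀ y, 0 ≤ q y / p y * m y := fun y =>
      mul_nonneg (div_nonneg (hq0 y) ((hm0 y).trans (hmp y))) (hm0 y)
    have h0 : q x / p x * m x = 0 := by rw [hx]; simp
    rw [ContinuousAt, h0]
    have hlim := hq.tendsto x
    rw [hpq x hx] at hlim
    exact squeeze_zero hge hle hlim
  · exact (hq.continuousAt.div hp.continuousAt hx).mul hm.continuousAt

theorem continuous_Lambda {e : ℝ ≃o ℝ}
    (he : e (1 / ((n : ℝ) + 1)) = 1 / ((n : ℝ) + 1)) (i : Fin (n + 1)) :
    Continuous fun x : Simplex n => Lambda n e x i := by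
  -- One formula for both cases of the definition, from which continuity across 1/(n+1) is visible.
  have h : ∀ x : Simplex n, Lambda n e x i = min (e (x i)) (1 / ((n : ℝ) + 1)) +
      deficit n e x / excess n x * max (x i - 1 / ((n : ℝ) + 1)) 0 := fun x => by
    rcases le_or_gt (x i) (1 / ((n : ℝ) + 1)) with hi | hi
    · rw [Lambda_of_le hi, min_eq_left ((apply_le_barycenter_iff he _).2 hi),
        max_eq_right (sub_nonpos.2 hi)]
      ring
    · rw [Lambda_of_lt hi, min_eq_right
        (not_le.1 (mt (apply_le_barycenter_iff he _).1 (not_le.2 hi))).le,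
        max_eq_left (sub_pos.2 hi).le]
  simp only [h]
  have hc := fun k => continuous_coord (n := n) k
  refine (((e.continuous.comp (hc i)).min continuous_const)).add
    (continuous_div_mul_of_le ?_ ?_ (((hc i).sub continuous_const).max continuous_const)
      (fun x => deficit_nonneg he x) (fun x => le_max_right _ _)
      (fun x => max_le (sub_le_excess x i) (excess_nonneg x))
      fun x hx => (deficit_eq_zero_iff he x).2 hx)
  · simp only [deficit_eq_sum_max he]
    exact continuous_finsetSum _ fun k _ =>
      (continuous_const.sub (e.continuous.comp (hc k))).max continuous_const
  · simp only [excess_eq_sum_max]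
    exact continuous_finsetSum _ fun k _ => ((hc k).sub continuous_const).max continuous_const

theorem Lambda_le_Lambda_iff {e : ℝ ≃o ℝ}
    (he : e (1 / ((n : ℝ) + 1)) = 1 / ((n : ℝ) + 1)) (x : Simplex n) (i j : Fin (n + 1)) :
    Lambda n e x i ≤ Lambda n e x j ↔ x i ≤ x j := by
  rcases le_or_gt (x i) (1 / ((n : ℝ) + 1)) with hi | hi <;>
    rcases le_or_gt (x j) (1 / ((n : ℝ) + 1)) with hj | hj
  · rw [Lambda_of_le hi, Lambda_of_le hj, e.le_iff_le]
  · have h1 := (Lambda_le_iff he x i).2 hi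
    have h2 := not_le.1 (mt (Lambda_le_iff he x j).1 (not_le.2 hj))
    exact iff_of_true (h1.trans h2.le) (hi.trans hj.le)
  · have h1 := (Lambda_le_iff he x j).2 hj
    have h2 := not_le.1 (mt (Lambda_le_iff he x i).1 (not_le.2 hi))
    exact iff_of_false (not_le.2 (h1.trans_lt h2)) (not_le.2 (hj.trans_lt hi))
  · rw [Lambda_of_lt hi, Lambda_of_lt hj, add_le_add_iff_left,
      mul_le_mul_iff_right₀ (div_pos (deficit_pos he hi) (excess_pos hi)), sub_le_sub_iff_right]

theorem Lambda_comp_perm (f : ℝ → ℝ) (x : Fin (n + 1) → ℝ) (σ : Equiv.Perm (Fin (n + 1)))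
    (i : Fin (n + 1)) : Lambda n f (fun l => x (σ l)) i = Lambda n f x (σ i) := by
  have h : lambdaDelta n f (fun l => x (σ l)) = lambdaDelta n f x := by
    unfold lambdaDelta lambdaD
    rw [Equiv.sum_comp σ (fun i => if x i ≤ 1 / ((n : ℝ) + 1) then x i - f (x i) else 0),
      Equiv.sum_comp σ (fun i => if x i ≤ 1 / ((n : ℝ) + 1) then 0 else x i - 1 / ((n : ℝ) + 1))]
  simp only [Lambda, h]

/-- For an increasing homeomorphism `e` that fixes `0` and `1 / (n + 1)`, the map `Λ_n(e)` is a
comfortable homeomorphism. -/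
theorem exists_Lambda_homeomorph {e : ℝ ≃o ℝ}
    (he : e (1 / ((n : ℝ) + 1)) = 1 / ((n : ℝ) + 1)) (h0 : e 0 = 0) : ∃ F : Simplex n ≃ₜ Simplex n,
    IsComfortable F ∧ ∀ x, ⇑(F x) = Lambda n e x := by
  have he' : e.symm (1 / ((n : ℝ) + 1)) = 1 / ((n : ℝ) + 1) := by
    rw [e.symm_apply_eq, he]
  have h0' : e.symm 0 = 0 := by rw [e.symm_apply_eq, h0]
  let F : Simplex n ≃ₜ Simplex n :=
    { toFun := fun x => ⟨Lambda n e x, Lambda_mem_stdSimplex he h0 x⟩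
      invFun := fun x => ⟨Lambda n e.symm x, Lambda_mem_stdSimplex he' h0' x⟩
      left_inv := fun x => Subtype.ext (Lambda_symm_Lambda he h0 x)
      right_inv := fun x => Subtype.ext (Lambda_symm_Lambda he' h0' x)
      continuous_toFun := continuous_of_coord fun k => continuous_Lambda he k
      continuous_invFun := continuous_of_coord fun k => continuous_Lambda he' k }
  have hF : ∀ x, ⇑(F x) = Lambda n e x := fun _ => rfl
  refine ⟨F, ⟨fun σ x x' hx l => ?_, fun x i j => ?_⟩, hF⟩
  · rw [hF, hF, ← Lambda_comp_perm, show ⇑x' = fun l => x (σ l) from funext hx]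
  · rw [hF]
    exact Lambda_le_Lambda_iff he x i j

/-! ### Piecewise linear functions with one kink -/

/-- The piecewise linear function through `(0, 0)`, `(a, b)` and `(c, c)`. -/
def kink (a b c t : ℝ) : ℝ :=
  if t ≤ a then b / a * t else b + (c - b) / (c - a) * (t - a)

theorem kink_of_le {a b c t : ℝ} (h : t ≤ a) : kink a b c t = b / a * t := if_pos h

theorem kink_of_lt {a b c t : ℝ} (h : a < t) :
    kink a b c t = b + (c - b) / (c - a) * (t - a) := if_neg (not_le.2 h)

theorem phi_eq_kink (n : ℕ) : phi n =
    kink (1 / (2 * ((n : ℝ) + 1))) (1 / (2 * ((n : ℝ) + 2))) (1 / ((n : ℝ) + 1)) := by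
  funext t
  simp [phi, kink, lineThrough]

theorem lt_kink_of_lt {a b c t : ℝ} (hac : a < c) (hbc : b < c) (ht : a < t) : b < kink a b c t := by
  rw [kink_of_lt ht]
  have := mul_pos (div_pos (sub_pos.2 hbc) (sub_pos.2 hac)) (sub_pos.2 ht)
  linarith

theorem kink_le_of_le {a b c t : ℝ} (ha : 0 < a) (hb : 0 < b) (ht : t ≤ a) : kink a b c t ≤ b := by
  rw [kink_of_le ht]
  calc b / a * t ≤ b / a * a := by gcongr
    _ = b := by field_simp

theorem strictMono_kink {a b c : ℝ} (ha : 0 < a) (hb : 0 < b) (hac : a < c)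
    (hbc : b < c) : StrictMono (kink a b c) := by
  intro s t hst
  rcases le_or_gt t a with ht | ht
  · rw [kink_of_le ht, kink_of_le (hst.le.trans ht)]
    exact mul_lt_mul_of_pos_left hst (div_pos hb ha)
  rcases le_or_gt s a with hs | hs
  · exact (kink_le_of_le ha hb hs).trans_lt (lt_kink_of_lt hac hbc ht)
  · rw [kink_of_lt ht, kink_of_lt hs]
    have := mul_lt_mul_of_pos_left (sub_lt_sub_right hst a)
      (div_pos (sub_pos.2 hbc) (sub_pos.2 hac))
    linarith

theorem kink_kink {a b c : ℝ} (ha : 0 < a) (hb : 0 < b) (hac : a < c)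
    (hbc : b < c) (t : ℝ) : kink a b c (kink b a c t) = t := by
  have hac' := (sub_pos.2 hac).ne'
  have hbc' := (sub_pos.2 hbc).ne'
  rcases le_or_gt t b with ht | ht
  · rw [kink_of_le (kink_le_of_le hb ha ht), kink_of_le ht]
    field_simp
  · rw [kink_of_lt (lt_kink_of_lt hbc hac ht), kink_of_lt ht]
    field_simp
    ring

theorem exists_Lambda_kink {a b c : ℝ} (ha : 0 < a) (hb : 0 < b) (hac : a < c)
    (hbc : b < c) {n : ℕ} (hc : c = 1 / ((n : ℝ) + 1)) :
    ∃ F : Simplex n ≃ₜ Simplex n, IsComfortable F ∧ ScalesBelow F a b ∧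
      ∀ x, ⇑(F x) = Lambda n (kink a b c) x := by
  -- The formula extends linearly to all of ℝ, and exchanging a and b inverts it.
  let e : ℝ ≃o ℝ := (strictMono_kink ha hb hac hbc).orderIsoOfRightInverse (kink a b c)
    (kink b a c) (kink_kink ha hb hac hbc)
  have hec : ⇑e = kink a b c := rfl
  have he : e (1 / ((n : ℝ) + 1)) = 1 / ((n : ℝ) + 1) := by
    rw [hec, ← hc, kink_of_lt hac, div_mul_cancel₀ _ (sub_pos.2 hac).ne']
    ring
  have h0 : e 0 = 0 := by rw [hec, kink_of_le ha.le, mul_zero]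
  obtain ⟨F, hF, hFe⟩ := exists_Lambda_homeomorph he h0
  refine ⟨F, hF, ⟨fun x i hx => ?_, fun x i hx => ?_⟩, hFe⟩
  · rw [hFe, Lambda_of_le (hx.trans (hac.le.trans hc.le)), hec, kink_of_le hx]
  · rw [hFe]
    rcases le_or_gt (x i) (1 / ((n : ℝ) + 1)) with hi | hi
    · rw [Lambda_of_le hi]
      exact lt_kink_of_lt hac hbc hx
    · exact (hbc.trans_eq hc).trans (not_le.1 (mt (Lambda_le_iff he x i).1 (not_le.2 hi)))

/-! ### Cancellation in the composite of two boundary operators -/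

theorem sum_neg_one_pow_smul_eq_zero {R M : Type*} [CommRing R] [AddCommGroup M] [Module R M]
    (a : Fin (n + 3) → Fin (n + 2) → M)
    (h : ∀ j p : Fin (n + 2), j ≤ p → a j.castSucc p = a p.succ j) :
    ∑ j : Fin (n + 3), ∑ p : Fin (n + 2), (-1 : R) ^ ((j : ℕ) + (p : ℕ)) • a j p = 0 := by
  rw [← Finset.sum_product', Finset.univ_product_univ]
  let S : Finset (Fin (n + 3) × Fin (n + 2)) := {q | (q.1 : ℕ) ≤ (q.2 : ℕ)}
  rw [← Finset.sum_add_sum_compl S, ← eq_neg_iff_add_eq_zero, ← Finset.sum_neg_distrib]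
  -- Pairs (j, p) with j ≤ p are matched with (p + 1, j), which carries the opposite sign.
  refine Finset.sum_bij' (fun q hq => (q.2.succ,
      Fin.castLT q.1 (lt_of_le_of_lt (Finset.mem_filter.mp hq).right (Fin.is_lt q.2))))
    (fun q hq => (q.2.castSucc, q.1.pred fun h0 => by simp [S, h0] at hq)) ?_ ?_ ?_ ?_ ?_
  · rintro ⟨j, p⟩ hq
    simp only [S, Finset.compl_filter, Finset.mem_filter_univ, Fin.val_succ,
      Fin.val_castLT] at hq ⊢
    lia
  · rintro ⟨j, p⟩ hq
    simp only [S, Finset.compl_filter, Finset.mem_filter_univ, Fin.val_castSucc,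
      Fin.val_pred] at hq ⊢
    lia
  · rintro ⟨j, p⟩ hq
    simp
  · rintro ⟨j, p⟩ hq
    simp
  · rintro ⟨j, p⟩ hq
    simp only [S, Finset.mem_filter_univ] at hq
    have hj : (j : ℕ) < n + 2 := lt_of_le_of_lt hq p.isLt
    have := h (j.castLT hj) p hq
    rw [Fin.castSucc_castLT] at this
    dsimp only
    rw [this, ← neg_smul]
    congr 1
    simp only [Fin.val_succ, Fin.val_castLT]
    ring

theorem boundary_comp_boundary {L : ℕ} (Θ : HomeoFamily L)
    (h : ∀ (j p : Fin (n + 2)), j ≤ p → ∀ i k, FaceEquation L Θ n j p i k)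
    {R : Type*} [CommRing R] (m : Fin (L + 1) → R) (X : Type*) [TopologicalSpace X] :
    (boundary Θ m X n) ∘ₗ (boundary Θ m X (n + 1)) = 0 := by
  refine Finsupp.lhom_ext' fun T => LinearMap.ext_ring ?_
  let a : Fin (n + 3) → Fin (n + 2) → Chain R X n := fun j p =>
    ∑ i : Fin (L + 1), ∑ k : Fin (L + 1), (m i * m k) •
      Finsupp.single (((((T.comp (faceMap L (n + 1) i j)).comp
        (Θ (n + 1) i : C(Simplex (n + 1), Simplex (n + 1)))).comp (faceMap L n k p)).comp
        (Θ n k : C(Simplex n, Simplex n)))) (1 : R)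
  have ha : ∀ j p : Fin (n + 2), j ≤ p → a j.castSucc p = a p.succ j := by
    intro j p hjp
    simp only [a]
    -- The face equation exchanges the roles of i and k, and the weight m_i m_k is symmetric.
    rw [Finset.sum_comm]
    refine Finset.sum_congr rfl fun i _ => Finset.sum_congr rfl fun k _ => ?_
    rw [mul_comm]
    congr 2
    ext x
    exact congrArg T (h j p hjp k i x)
  have key := sum_neg_one_pow_smul_eq_zero (R := R) a ha
  simp only [LinearMap.comp_apply, Finsupp.lsingle_apply, LinearMap.zero_apply]
  rw [← key]
  simp only [boundary, Finsupp.linearCombination_single, map_sum, map_smul, a,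
    Finset.smul_sum, smul_smul, pow_add]
  refine Finset.sum_congr rfl fun j _ => ?_
  rw [Finset.sum_comm]
  refine Finset.sum_congr rfl fun p _ => Finset.sum_congr rfl fun i _ =>
    Finset.sum_congr rfl fun k _ => ?_
  congr 1
  ring

/-! ### The face equation in coordinates -/

theorem castSucc_succAbove_of_le {j p : Fin (n + 2)} (h : j ≤ p) :
    j.castSucc.succAbove p = p.succ :=
  Fin.succAbove_of_le_castSucc _ _ (Fin.castSucc_le_castSucc_iff.2 h)

theorem succ_succAbove_of_le {j p : Fin (n + 2)} (h : j ≤ p) :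
    p.succ.succAbove j = j.castSucc :=
  Fin.succAbove_of_castSucc_lt _ _ (Fin.castSucc_lt_succ_iff.2 h)

theorem castSucc_succAbove_succAbove {j p : Fin (n + 2)} (h : j ≤ p) (r : Fin (n + 1)) :
    j.castSucc.succAbove (p.succAbove r) = p.succ.succAbove (j.succAbove r) := by
  simp only [Fin.succAbove, Fin.lt_def, Fin.le_def, Fin.ext_iff] at *
  split_ifs <;> simp_all <;> lia

theorem faceMap_same (L n : ℕ) (i : Fin (L + 1)) (j : Fin (n + 2)) (x : Simplex n) :
    faceMap L n i j x j = height L (n + 1) i := by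
  rw [faceMap_eq_insertCoord, insertCoord_same]

theorem faceMap_succAbove (L n : ℕ) (i : Fin (L + 1)) (j : Fin (n + 2)) (x : Simplex n)
    (k : Fin (n + 1)) :
    faceMap L n i j x (j.succAbove k) = (1 - height L (n + 1) i) * x k := by
  rw [faceMap_eq_insertCoord, insertCoord_succAbove]

/-- The hypotheses treat position j (`hik`), position p + 1 (`hki`) and the positions inserted by
neither map (`hrest`). -/
theorem faceEquation_of_coord {L : ℕ} (Θ : HomeoFamily L) {i k : Fin (L + 1)}
    (hik : ∀ j (y : Simplex n),
      (1 - height L (n + 2) k) * Θ (n + 1) k (faceMap L n i j y) j = height L (n + 2) i)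
    (hki : ∀ j (y : Simplex n),
      (1 - height L (n + 2) i) * Θ (n + 1) i (faceMap L n k j y) j = height L (n + 2) k)
    (hrest : ∀ j p (x : Simplex n) r,
      (1 - height L (n + 2) i) * Θ (n + 1) i (faceMap L n k p (Θ n k x)) (p.succAbove r) =
        (1 - height L (n + 2) k) * Θ (n + 1) k (faceMap L n i j (Θ n i x)) (j.succAbove r))
    {j p : Fin (n + 2)} (hjp : j ≤ p) : FaceEquation L Θ n j p i k := by
  intro x
  refine ext_succAbove j.castSucc ?_ fun l => ?_
  · rw [faceMap_same, ← succ_succAbove_of_le hjp, faceMap_succAbove, hik]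
  · rw [faceMap_succAbove]
    rcases Fin.eq_self_or_eq_succAbove p l with rfl | ⟨r, rfl⟩
    · rw [castSucc_succAbove_of_le hjp, faceMap_same, hki]
    · rw [castSucc_succAbove_succAbove hjp, faceMap_succAbove, hrest j p]

/-! ### The levels 1/(2(n+1)) and 1/(2(n+1)+1) -/

/-- The number `1 / (2 (n + 1))`. -/
def level (n : ℕ) : ℝ := 1 / (2 * ((n : ℝ) + 1))

/-- The number `1 / (2 (n + 1) + 1)`. -/
def crossLevel (n : ℕ) : ℝ := 1 / (2 * ((n : ℝ) + 1) + 1)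

theorem level_pos (n : ℕ) : 0 < level n := by
  unfold level; positivity

theorem crossLevel_pos (n : ℕ) : 0 < crossLevel n := by
  unfold crossLevel; positivity

theorem crossLevel_lt_level (n : ℕ) : crossLevel n < level n := by
  unfold level crossLevel
  gcongr
  linarith

theorem level_lt (n : ℕ) : level n < 1 / ((n : ℝ) + 1) := by
  unfold level
  gcongr
  have : (0 : ℝ) ≤ n := n.cast_nonneg
  linarith

theorem level_succ_lt (n : ℕ) : level (n + 1) < level n := by
  unfold level
  gcongr
  simp

theorem level_lt_one (n : ℕ) : level n < 1 :=
  (level_lt n).trans_le (by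
    rw [div_le_one (by positivity)]
    have : (0 : ℝ) ≤ n := n.cast_nonneg
    linarith)

/-- This identity dictates the target level of Θ_{n,1}: multiplication by 1 - l_{n+1} must bring c_n
back to l_{n+1}. -/
theorem level_div_one_sub (n : ℕ) : level (n + 1) / (1 - level (n + 1)) = crossLevel n := by
  have h := sub_pos.2 (level_lt_one (n + 1))
  rw [div_eq_iff h.ne']
  unfold level crossLevel
  push_cast
  field_simp
  ring

theorem height_zero (n : ℕ) : height 1 n 0 = 0 := by
  simp [height]

theorem height_one (n : ℕ) : height 1 n 1 = level n := by
  simp [height, level]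
  norm_num

/-- `level n` as an element of the unit interval. -/
def levelI (n : ℕ) : unitInterval := ⟨level n, (level_pos n).le, (level_lt_one n).le⟩

theorem faceMap_zero (j : Fin (n + 2)) (x : Simplex n) :
    faceMap 1 n 0 j x = insertCoord 0 j x := by
  rw [faceMap_eq_insertCoord]
  congr 1
  exact Subtype.ext (height_zero (n + 1))

theorem faceMap_one (j : Fin (n + 2)) (x : Simplex n) :
    faceMap 1 n 1 j x = insertCoord (levelI (n + 1)) j x := by
  rw [faceMap_eq_insertCoord]
  congr 1
  exact Subtype.ext (height_one (n + 1))

/-! ### Construction of Θ_{n,0} and Θ_{n,1} -/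

theorem exists_thetaZero (n : ℕ) : ∃ F : Simplex n ≃ₜ Simplex n, IsComfortable F ∧
    ScalesBelow F (level n) (level (n + 1)) ∧ ∀ x, ⇑(F x) = Lambda n (phi n) x := by
  have hphi : phi n = kink (level n) (level (n + 1)) (1 / ((n : ℝ) + 1)) := by
    rw [phi_eq_kink, level, level]
    congr 2
    push_cast
    ring
  rw [hphi]
  exact exists_Lambda_kink (level_pos n) (level_pos (n + 1)) (level_lt n)
    ((level_succ_lt n).trans (level_lt n)) rfl

/-- A comfortable homeomorphism of `Δ_n` that fixes the coordinates up to `α` extends from the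
faces of `Δ_{n+1}` to a comfortable homeomorphism with the same property. -/
theorem IsComfortable.exists_extension {F : Simplex n ≃ₜ Simplex n} (hF : IsComfortable F) {α : ℝ}
    (hα : 0 < α) (hα' : α ≤ 1 / ((n : ℝ) + 2)) (hFα : ScalesBelow F α α) :
    ∃ G : Simplex (n + 1) ≃ₜ Simplex (n + 1), IsComfortable G ∧ ScalesBelow G α α ∧
      ∀ j x, G (insertCoord 0 j x) = insertCoord 0 j (F x) := by
  obtain ⟨G, hG, hGF⟩ := hF.exists_cone fun x k => by
    simpa using hFα.eq_iff hα hα hα.le x k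
  have hfix : ∀ {f : Simplex n → Simplex n}, ScalesBelow f α α → ∀ x k, x k ≤ α → f x k = x k := by
    intro f hf x k hx
    rw [hf.eq_mul x k hx, div_self hα.ne', one_mul]
  have hGF' : ∀ j s w, G.symm (conePoint j s w) = conePoint j s (F.symm w) := fun j s w => by
    rw [G.symm_apply_eq, hGF, F.apply_symm_apply]
  refine ⟨G, hG, ⟨fun x i hx => ?_, fun x i hx => ?_⟩, fun j x => ?_⟩
  · rw [cone_apply_of_le hGF hα' (hfix hFα) x i hx, div_self hα.ne', one_mul]
  -- The inverse of G is the cone of F⁻¹ and fixes coordinates up to α too, so x i = G x i ≤ α.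
  · by_contra! hle
    have := cone_apply_of_le hGF' hα' (hfix (hFα.symm hα hα)) (G x) i hle
    rw [G.symm_apply_apply] at this
    linarith
  · rw [← conePoint_one, hGF, conePoint_one]

/-- The inductive step of the construction of the homeomorphisms `Θ_{n,1}`. -/
theorem exists_thetaOne_succ {T : Simplex n ≃ₜ Simplex n} (hT : IsComfortable T)
    (hT' : ScalesBelow T (level n) (level (n + 1)))
    {S : Simplex (n + 1) ≃ₜ Simplex (n + 1)} (hS : IsComfortable S)
    (hS' : ScalesBelow S (level (n + 1)) (level (n + 2)))
    {F : Simplex n ≃ₜ Simplex n} (hF : IsComfortable F)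
    (hF' : ScalesBelow F (level n) (crossLevel n)) :
    ∃ G : Simplex (n + 1) ≃ₜ Simplex (n + 1),
      (IsComfortable G ∧ ScalesBelow G (level (n + 1)) (crossLevel (n + 1))) ∧
      ∃ H : Simplex n → Simplex n, ∀ j x,
        S (insertCoord (levelI (n + 1)) j (F x)) = insertCoord (levelI (n + 2)) j (H x) ∧
        G (insertCoord 0 j (T x)) = insertCoord 0 j (H x) := by
  have hl := level_pos
  have hc := crossLevel_pos
  -- P provides the scaling required of G on all of Δ_{n+1}; Q is what it induces on the faces.
  obtain ⟨P, hP, hP', -⟩ := exists_Lambda_kink (n := n + 1) (hl (n + 1)) (hc (n + 1))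
    (level_lt (n + 1)) ((crossLevel_lt_level (n + 1)).trans (level_lt (n + 1))) rfl
  obtain ⟨Q, hQ, hPQ⟩ := hP.exists_restrict (a := 0) (b := 0) (by simp) (by simp) fun x j => by
    simpa using hP'.eq_iff (hl _) (hc _) (hl _).le x j
  have hQ' := hP'.restrict (a := 0) (b := 0) (by simp) (by simp) hPQ
  obtain ⟨U, hU, hSU⟩ := hS.exists_restrict (a := levelI (n + 1)) (b := levelI (n + 2))
    (level_lt_one _) (level_lt_one _) fun x j => by
      simpa [levelI, div_mul_cancel₀ _ (hl (n + 1)).ne'] using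
        hS'.eq_iff (hl _) (hl _) le_rfl x j
  have hU' := hS'.restrict (level_lt_one _) (level_lt_one _) hSU
  simp only [levelI, level_div_one_sub, Set.Icc.coe_zero, sub_zero, div_one] at hU' hQ'
  -- The correction U F T⁻¹ Q⁻¹ moves the threshold from c_{n+1} through l_{n+1}, l_n and c_n back
  -- to c_{n+1}.
  have hUα : ScalesBelow ((((Q.symm).trans T.symm).trans F).trans U) (crossLevel (n + 1))
      (crossLevel (n + 1)) :=
    ((((hQ'.symm (hl _) (hc _)).trans (hT'.symm (hl _) (hl _)) (hc _) (hl _)).trans hF'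
      (hc _) (hl _)).trans hU' (hc _) (hc _))
  obtain ⟨G, hG, hG', hGU⟩ := (((hQ.symm.trans hT.symm).trans hF).trans hU).exists_extension
    (hc (n + 1)) (((crossLevel_lt_level (n + 1)).trans (level_lt (n + 1))).le.trans_eq (by
      push_cast; ring)) hUα
  refine ⟨P.trans G, ⟨hP.trans hG, hP'.trans hG' (hl _) (hc _)⟩, fun x => U (F x),
    fun j x => ⟨hSU j (F x), ?_⟩⟩
  simp [hPQ, hGU]

theorem exists_thetaOne {Z : ∀ n, Simplex n ≃ₜ Simplex n} (hZ : ∀ n, IsComfortable (Z n))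
    (hZ' : ∀ n, ScalesBelow (Z n) (level n) (level (n + 1))) :
    ∃ F : ∀ n, Simplex n ≃ₜ Simplex n,
      (∀ n, IsComfortable (F n) ∧ ScalesBelow (F n) (level n) (crossLevel n)) ∧
      ∀ n, ∃ H : Simplex n → Simplex n, ∀ j x,
        Z (n + 1) (insertCoord (levelI (n + 1)) j (F n x)) =
          insertCoord (levelI (n + 2)) j (H x) ∧
        F (n + 1) (insertCoord 0 j (Z n x)) = insertCoord 0 j (H x) := by
  -- The only coordinate on Δ_0 is 1, above both levels, so linearity below `level 0` is vacuous.
  have hbase : ScalesBelow (Homeomorph.refl (Simplex 0)) (level 0) (crossLevel 0) := by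
    have hx : ∀ (x : Simplex 0) i, x i = 1 := fun x i => by
      rw [← stdSimplex.sum_eq_one x, Fin.sum_univ_one, Fin.fin_one_eq_zero i]
    refine ⟨fun x i h => ?_, fun x i _ => ?_⟩
    · exact absurd (level_lt_one 0) (not_lt.2 ((hx x i) ▸ h))
    · rw [Homeomorph.refl_apply, hx]
      exact (crossLevel_lt_level 0).trans (level_lt_one 0)
  have hstep : ∀ n (F : {F : Simplex n ≃ₜ Simplex n // IsComfortable F ∧
      ScalesBelow F (level n) (crossLevel n)}), _ := fun n F =>
    exists_thetaOne_succ (hZ n) (hZ' n) (hZ (n + 1)) (hZ' (n + 1)) F.2.1 F.2.2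
  choose G hG hH using hstep
  let F : ∀ n, {F : Simplex n ≃ₜ Simplex n // IsComfortable F ∧
      ScalesBelow F (level n) (crossLevel n)} := fun n =>
    Nat.rec ⟨Homeomorph.refl _, IsComfortable.refl, hbase⟩ (fun n F => ⟨G n F, hG n F⟩) n
  exact ⟨fun n => (F n).1, fun n => (F n).2, fun n => hH n (F n)⟩

end SimplexBoundary

end

open SimplexBoundary

/-! ### The theorem -/

theorem theorem2 :
    ∃ Θ : HomeoFamily 1,
      -- `Θ_{n,0} = Λ_n(φ_{n,0})`
      (∀ (n : ℕ) (x : Simplex n),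
        ⇑(Θ n 0 x) = Lambda n (phi n) ⇑x) ∧
      (∀ n : ℕ, Θ n 0 ∈ Comfort n) ∧
      (∀ n : ℕ, Θ n 1 ∈ Comfort n) ∧
      (∀ (n : ℕ) (j p : Fin (n + 2)), j ≤ p → ∀ i k : Fin 2, FaceEquation 1 Θ n j p i k) ∧
      -- `Θ_{n,1}` restricts to a homeomorphism between the two crosses
      (∀ n : ℕ, ∃ h : cross n (1 / (2 * ((n : ℝ) + 1))) ≃ₜ cross n (1 / (2 * ((n : ℝ) + 1) + 1)),
        ∀ x, ((h x : cross n _) : Simplex n) = Θ n 1 (x : Simplex n)) ∧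
      (∀ (R : Type*) [CommRing R] (X : Type*) [TopologicalSpace X] (m : Fin 2 → R) (n : ℕ),
        (boundary Θ m X n) ∘ₗ (boundary Θ m X (n + 1)) = 0) := by
  choose Z hZ hZ' hZeq using exists_thetaZero
  obtain ⟨F, hF, hFZ⟩ := exists_thetaOne hZ hZ'
  let Θ : HomeoFamily 1 := fun n => ![Z n, F n]
  have hΘ0 : ∀ n, Θ n 0 = Z n := fun _ => rfl
  have hΘ1 : ∀ n, Θ n 1 = F n := fun _ => rfl
  have hl := level_pos
  have hc := crossLevel_pos
  have hsame : ∀ n (i k : Fin 2) j (y : Simplex n),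
      (1 - height 1 (n + 2) k) * Θ (n + 1) k (faceMap 1 n i j y) j = height 1 (n + 2) i := by
    intro n i k j y
    have hZ0 := (hZ' (n + 1)).eq_mul (faceMap 1 n i j y) j
    have hF0 := (hF (n + 1)).2.eq_mul (faceMap 1 n i j y) j
    rw [faceMap_same] at hZ0 hF0
    -- For i = 0 the value 0 is kept. For i = 1 the level l_{n+1} goes to l_{n+2} if k = 0, and to
    -- c_{n+1} = l_{n+2}/(1 - l_{n+2}) if k = 1.
    fin_cases i <;> fin_cases k
    · simp only [Fin.zero_eta, height_zero, hΘ0] at *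
      rw [hZ0 (hl _).le]
      ring
    · simp only [Fin.zero_eta, Fin.mk_one, height_zero, hΘ1] at *
      rw [hF0 (hl _).le]
      ring
    · simp only [Fin.zero_eta, Fin.mk_one, height_zero, height_one, hΘ0] at *
      rw [hZ0 le_rfl, div_mul_cancel₀ _ (hl _).ne']
      ring
    · simp only [Fin.mk_one, height_one, hΘ1] at *
      rw [hF0 le_rfl, div_mul_cancel₀ _ (hl _).ne', ← level_div_one_sub,
        mul_div_cancel₀ _ (sub_pos.2 (level_lt_one _)).ne']
  have hcomf : ∀ n (i : Fin 2), IsComfortable (Θ n i) := fun n i => by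
    fin_cases i
    exacts [hZ n, (hF n).1]
  have hrest : ∀ n (i k : Fin 2) j p (x : Simplex n) r,
      (1 - height 1 (n + 2) i) * Θ (n + 1) i (faceMap 1 n k p (Θ n k x)) (p.succAbove r) =
        (1 - height 1 (n + 2) k) * Θ (n + 1) k (faceMap 1 n i j (Θ n i x)) (j.succAbove r) := by
    intro n i k j p x r
    -- For i = k both sides insert the same value into the same point, at different positions, and
    -- equivariance compares them.
    have hdiag : ∀ i : Fin 2, Θ (n + 1) i (faceMap 1 n i p (Θ n i x)) (p.succAbove r) =
        Θ (n + 1) i (faceMap 1 n i j (Θ n i x)) (j.succAbove r) := fun i => by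
      rw [faceMap_eq_insertCoord, (hcomf (n + 1) i).equivariant (extendPerm p j 1) _ _
        (insertCoord_extendPerm _ p j 1 fun _ => rfl), extendPerm_succAbove, faceMap_eq_insertCoord]
      rfl
    obtain ⟨H, hH⟩ := hFZ n
    fin_cases i <;> fin_cases k
    · exact congrArg _ (hdiag 0)
    · simp only [Fin.zero_eta, Fin.mk_one, height_zero, height_one, hΘ0, hΘ1, faceMap_zero,
        faceMap_one, (hH _ _).1, (hH _ _).2, insertCoord_succAbove]
      simp [levelI]
    · simp only [Fin.zero_eta, Fin.mk_one, height_zero, height_one, hΘ0, hΘ1, faceMap_zero,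
        faceMap_one, (hH _ _).1, (hH _ _).2, insertCoord_succAbove]
      simp [levelI]
    · exact congrArg _ (hdiag 1)
  have hface : ∀ (n : ℕ) (j p : Fin (n + 2)), j ≤ p → ∀ i k : Fin 2, FaceEquation 1 Θ n j p i k :=
    fun n j p hjp i k => faceEquation_of_coord Θ (hsame n i k) (hsame n k i) (hrest n i k) hjp
  refine ⟨Θ, hZeq, fun n => (hZ n).mem_comfort, fun n => (hF n).1.mem_comfort, hface, fun n => ?_,
    fun R _ X _ m n => boundary_comp_boundary Θ (hface n) m X⟩
  -- The scaling property at t = `level n`, one coordinate at a time.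
  have hcross : ∀ x, x ∈ cross n (1 / (2 * ((n : ℝ) + 1))) ↔
      F n x ∈ cross n (1 / (2 * ((n : ℝ) + 1) + 1)) := fun x =>
    exists_congr fun j => by
      have := (hF n).2.eq_iff (hl n) (hc n) le_rfl x j
      rw [div_mul_cancel₀ _ (hl n).ne'] at this
      exact this.symm
  exact ⟨(F n).subtype hcross, fun _ => rfl⟩
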